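/- For a compact topological group $G$ let $\widehat G$ be the set of equivalence classes of (continuous, finite-dimensional) irreducible complex representations of $G$, and for $g_1,\dots,g_r\in G$ let $$\zeta^W_G(s;g_1,\dots,g_r)=\sum_{\rho\in\widehat G}\frac{\operatorname{tr}\rho(g_1)}{\deg\rho}\cdots\frac{\operatorname{tr}\rho(g_r)}{\deg\rho}\,(\deg\rho)^{-s}.$$ Let $g_1,g_2\in SU(2)$. Then the series $\zeta^W_{SU(2)}(s;g_1,g_2)=\sum_{\rho}\frac{\operatorname{tr}\rho(g_1)\operatorname{tr}\rho(g_2)}{(\deg\rho)^{s+2}}$ converges absolutely for $\operatorname{Re}(s)$ sufficiently large and has a meromorphic continuation in $s$ to the whole complex plane. For every positive even integer $m$ this continuation is holomorphic at $s=-m$ and $$\zeta^W_{SU(2)}(-m;g_1,g_2)=0.$$ -/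

import Mathlib

noncomputable section

namespace WittenL

/-- A finite-dimensional continuous irreducible complex representation of a topological group `G`,
realised on the coordinate space `ℂⁿ` (irreducible includes nonzero). -/
structure Irrep (G : Type*) [Group G] [TopologicalSpace G] where
  deg : ℕ
  rep : Representation ℂ G (Fin deg → ℂ)
  continuous_rep : ∀ v : Fin deg → ℂ, Continuous fun g : G => rep g v
  irreducible : rep.IsIrreducible

variable (G : Type*) [Group G] [TopologicalSpace G]

/-- Two representations are equivalent if there is an invertible linear map intertwining them. -/
instance irrepSetoid : Setoid (Irrep G) where
  r ρ σ := ∃ e : (Fin ρ.deg → ℂ) ≃ₗ[ℂ] (Fin σ.deg → ℂ), ∀ g v, e (ρ.rep g v) = σ.rep g (e v)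
  iseqv :=
    { refl := fun _ => ⟨LinearEquiv.refl ℂ _, fun _ _ => rfl⟩
      symm := by
        rintro ρ σ ⟨e, he⟩
        refine ⟨e.symm, fun g v => ?_⟩
        rw [LinearEquiv.symm_apply_eq, he, LinearEquiv.apply_symm_apply]
      trans := by
        rintro ρ σ τ ⟨e, he⟩ ⟨f, hf⟩
        exact ⟨e.trans f, fun g v => by simp [he, hf]⟩ }

/-- The dual of `G`: equivalence classes of irreducible representations. -/
def Dual : Type _ := Quotient (irrepSetoid G)

variable {G}

/-- The degree (dimension) of a class of representations. -/
def Dual.deg (c : Dual G) : ℕ :=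
  Quotient.lift (fun ρ : Irrep G => ρ.deg) (by
    rintro ρ σ ⟨e, -⟩
    simpa using e.finrank_eq) c

/-- The character `g ↦ tr ρ(g)` of a class of representations. -/
def Dual.char (c : Dual G) (g : G) : ℂ :=
  Quotient.lift (fun ρ : Irrep G => LinearMap.trace ℂ (Fin ρ.deg → ℂ) (ρ.rep g)) (by
    rintro ρ σ ⟨e, he⟩
    have h : σ.rep g = e.conj (ρ.rep g) := by
      apply LinearMap.ext
      intro v
      rw [LinearEquiv.conj_apply_apply, he, LinearEquiv.apply_symm_apply]
    change LinearMap.trace ℂ _ (ρ.rep g) = LinearMap.trace ℂ _ (σ.rep g)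
    rw [h, LinearMap.trace_conj']) c

/-- The summand of the Witten `L`-series at the class `c`:
`∏ᵢ (tr ρ(gᵢ) / deg ρ) * (deg ρ)^(-s)`. -/
def wittenTerm {r : ℕ} (g : Fin r → G) (s : ℂ) (c : Dual G) : ℂ :=
  (∏ i, c.char (g i) / (c.deg : ℂ)) * (c.deg : ℂ) ^ (-s)

/-- `F` is the Witten `L`-function `s ↦ ζ(s; g₁, …, g_r)` of `G`: the meromorphic function on `ℂ`
(with removable singularities removed) that is the sum of the absolutely convergent Witten
`L`-series on some right half-plane. Such an `F` is unique by the identity theorem, given that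
normal form fixes its value (to be `0`) at the poles. -/
def IsWittenLFunction {r : ℕ} (g : Fin r → G) (F : ℂ → ℂ) : Prop :=
  MeromorphicNFOn F Set.univ ∧
    ∃ σ : ℝ, ∀ s : ℂ, σ < s.re → HasSum (wittenTerm g s) (F s)

end WittenL

end

/-! The irreducible representations of `SU(2)` are the symmetric powers of the standard one: one in
each degree `N = n + 1`, with character `U_n(cos θ) = sin (Nθ) / sin θ` at an element with
eigenvalues `exp (± iθ)`. So the `L`-series is an explicit Dirichlet series in `N`, and three cases
arise. If both sines are nonzero, product-to-sum gives a multiple of `cosZeta (s + 2) - cosZeta (s +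
2)` at the angles `θ₁ - θ₂` and `θ₁ + θ₂`. If one element is `± 1`, a multiple of `sinZeta (s + 1)`
appears; if both are, `± cosZeta s`. At `s = -m` with `m` even these are trivial zeros, except for
`m = 2` in the first case, where both terms are the constant `cosZeta 0 = -1/2` and cancel
(`hasContinuation_U_mul_U`). For the classification (`exists_equiv_symIrrep`), a character outside
the list would be orthogonal to every `U_n` of the half trace, hence to all polynomials in it. By
Weierstrass approximation it would be orthogonal to itself, against Schur orthogonality. -/

open MeasureTheory Filter Topology

namespace WittenL

/-! ### Orthogonality of matrix coefficients for a compact group -/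

section Orthogonality

variable {G : Type*} [Group G] [TopologicalSpace G] [IsTopologicalGroup G] [CompactSpace G]
  [MeasurableSpace G] [BorelSpace G] {m n : ℕ}

/-- The entrywise Haar integral of `R g * A * S g⁻¹`. -/
noncomputable def haarAverage (μ : Measure G) (R : G →* Matrix (Fin m) (Fin m) ℂ)
    (S : G →* Matrix (Fin n) (Fin n) ℂ) (A : Matrix (Fin m) (Fin n) ℂ) :
    Matrix (Fin m) (Fin n) ℂ :=
  Matrix.of fun i l => ∫ g, (R g * A * S g⁻¹) i l ∂μ

theorem integrable_entry_mul (μ : Measure G) [IsFiniteMeasure μ]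
    {R : G →* Matrix (Fin m) (Fin m) ℂ} {S : G →* Matrix (Fin n) (Fin n) ℂ}
    (hR : Continuous R) (hS : Continuous S) (i j : Fin m) (k l : Fin n) :
    Integrable (fun g => R g i j * S g⁻¹ k l) μ := by
  have h : Continuous fun g => R g i j * S g⁻¹ k l :=
    (hR.matrix_elem i j).mul ((hS.comp continuous_inv).matrix_elem k l)
  exact h.integrable_of_hasCompactSupport (HasCompactSupport.of_compactSpace _)

theorem integrable_sandwich (μ : Measure G) [IsFiniteMeasure μ]
    {R : G →* Matrix (Fin m) (Fin m) ℂ} {S : G →* Matrix (Fin n) (Fin n) ℂ}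
    (hR : Continuous R) (hS : Continuous S) (A : Matrix (Fin m) (Fin n) ℂ) (i : Fin m)
    (l : Fin n) : Integrable (fun g => (R g * A * S g⁻¹) i l) μ := by
  have h : Continuous fun g => R g * A * S g⁻¹ :=
    (hR.matrix_mul continuous_const).matrix_mul (hS.comp continuous_inv)
  exact (h.matrix_elem i l).integrable_of_hasCompactSupport (HasCompactSupport.of_compactSpace _)

/-- The substitution `g ↦ h * g` absorbs `R h` on the left and releases `S h` on the right. -/
theorem haarAverage_intertwines (μ : Measure G) [IsFiniteMeasure μ] [μ.IsMulLeftInvariant]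
    {R : G →* Matrix (Fin m) (Fin m) ℂ} {S : G →* Matrix (Fin n) (Fin n) ℂ}
    (hR : Continuous R) (hS : Continuous S) (A : Matrix (Fin m) (Fin n) ℂ) (h : G) :
    R h * haarAverage μ R S A = haarAverage μ R S A * S h := by
  have key : ∀ g, R h * (R g * A * S g⁻¹) = R (h * g) * A * S (h * g)⁻¹ * S h := by
    intro g
    have : S g⁻¹ = S (h * g)⁻¹ * S h := by rw [← map_mul]; congr 1; group
    rw [this, map_mul]
    simp only [Matrix.mul_assoc]
  ext i l
  have e1 : (R h * haarAverage μ R S A) i l = ∫ g, (R h * (R g * A * S g⁻¹)) i l ∂μ := by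
    simp only [Matrix.mul_apply (M := R h), haarAverage, Matrix.of_apply]
    rw [integral_finsetSum]
    · simp only [integral_const_mul]
    · exact fun j _ => (integrable_sandwich μ hR hS A j l).const_mul _
  have e2 : (haarAverage μ R S A * S h) i l = ∫ g, (R g * A * S g⁻¹ * S h) i l ∂μ := by
    simp only [Matrix.mul_apply (N := S h), haarAverage, Matrix.of_apply]
    rw [integral_finsetSum]
    · simp only [integral_mul_const]
    · exact fun j _ => (integrable_sandwich μ hR hS A i j).mul_const _
  rw [e1, e2]
  simp only [key]
  exact integral_mul_left_eq_self (μ := μ) (fun g => (R g * A * S g⁻¹ * S h) i l) h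

theorem sandwich_single (P : Matrix (Fin m) (Fin m) ℂ) (Q : Matrix (Fin n) (Fin n) ℂ)
    (i j : Fin m) (k l : Fin n) : (P * Matrix.single j k (1 : ℂ) * Q) i l = P i j * Q k l := by
  rw [Matrix.mul_assoc, Matrix.mul_apply, Finset.sum_eq_single j]
  · simp
  · intro b _ hb
    rw [Matrix.single_mul_apply_of_ne _ _ _ _ _ hb, mul_zero]
  · simp

/-- Each product of diagonal entries is an entry of a matrix unit sandwiched between `R g` and `S
g⁻¹`, so Schur's lemma can be applied to the averages. -/
theorem integral_trace_mul_trace (μ : Measure G) [IsFiniteMeasure μ]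
    {R : G →* Matrix (Fin m) (Fin m) ℂ} {S : G →* Matrix (Fin n) (Fin n) ℂ}
    (hR : Continuous R) (hS : Continuous S) :
    ∫ g, (R g).trace * (S g⁻¹).trace ∂μ =
      ∑ i, ∑ k, haarAverage μ R S (Matrix.single i k 1) i k := by
  simp only [Matrix.trace, Matrix.diag_apply, Finset.sum_mul_sum, haarAverage, Matrix.of_apply,
    sandwich_single]
  rw [integral_finsetSum]
  · refine Finset.sum_congr rfl fun i _ => ?_
    rw [integral_finsetSum]
    exact fun k _ => integrable_entry_mul μ hR hS i i k k
  · exact fun i _ => integrable_finsetSum _ fun k _ => integrable_entry_mul μ hR hS i i k k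

theorem integral_trace_mul_trace_eq_zero (μ : Measure G) [IsFiniteMeasure μ]
    [μ.IsMulLeftInvariant]
    {R : G →* Matrix (Fin m) (Fin m) ℂ} {S : G →* Matrix (Fin n) (Fin n) ℂ}
    (hR : Continuous R) (hS : Continuous S)
    (hom : ∀ T : Matrix (Fin m) (Fin n) ℂ, (∀ g, R g * T = T * S g) → T = 0) :
    ∫ g, (R g).trace * (S g⁻¹).trace ∂μ = 0 := by
  rw [integral_trace_mul_trace μ hR hS]
  refine Finset.sum_eq_zero fun i _ => Finset.sum_eq_zero fun k _ => ?_
  rw [hom _ (haarAverage_intertwines μ hR hS _)]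
  rfl

theorem integral_trace_mul_trace_inv (μ : Measure G) [IsProbabilityMeasure μ]
    [μ.IsMulLeftInvariant]
    {R : G →* Matrix (Fin n) (Fin n) ℂ} (hR : Continuous R) (hn : n ≠ 0)
    (hom : ∀ T : Matrix (Fin n) (Fin n) ℂ, (∀ g, R g * T = T * R g) → ∃ c : ℂ, T = c • 1) :
    ∫ g, (R g).trace * (R g⁻¹).trace ∂μ = 1 := by
  rw [integral_trace_mul_trace μ hR hR]
  have key : ∀ i k : Fin n, haarAverage μ R R (Matrix.single i k 1) i k =
      if i = k then (n : ℂ)⁻¹ else 0 := by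
    intro i k
    obtain ⟨c, hc⟩ := hom _ (haarAverage_intertwines μ hR hR (Matrix.single i k 1))
    -- Conjugation preserves the trace and the measure has mass one, so the scalar `c` satisfies `c
    -- * n = δ_ik`.
    have ht : (haarAverage μ R R (Matrix.single i k 1)).trace =
        (Matrix.single i k (1 : ℂ)).trace := by
      simp only [Matrix.trace, Matrix.diag_apply, haarAverage, Matrix.of_apply]
      rw [← integral_finsetSum _ fun j _ => integrable_sandwich μ hR hR _ j j]
      have : ∀ g, ∑ j, (R g * Matrix.single i k (1 : ℂ) * R g⁻¹) j j =
          (Matrix.single i k (1 : ℂ)).trace := by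
        intro g
        change (R g * Matrix.single i k (1 : ℂ) * R g⁻¹).trace = _
        rw [Matrix.trace_mul_comm, ← Matrix.mul_assoc, ← map_mul, inv_mul_cancel, map_one, one_mul]
      simp only [this, integral_const, probReal_univ, one_smul]
      rfl
    rw [hc, Matrix.trace_smul, Matrix.trace_one, Fintype.card_fin] at ht
    rw [hc]
    have hn' : (n : ℂ) ≠ 0 := Nat.cast_ne_zero.mpr hn
    by_cases hik : i = k
    · subst hik
      rw [Matrix.trace_single_eq_same] at ht
      simp only [Matrix.smul_apply, Matrix.one_apply_eq, smul_eq_mul, mul_one, if_true]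
      exact eq_inv_of_mul_eq_one_left (by simpa using ht)
    · simp [hik]
  simp only [key, Finset.sum_ite_eq, Finset.mem_univ, if_true, Finset.sum_const,
    Finset.card_univ, Fintype.card_fin, nsmul_eq_mul]
  exact mul_inv_cancel₀ (Nat.cast_ne_zero.mpr hn)

end Orthogonality

/-! ### Schur's lemma and orthogonality of irreducible characters -/

section IrrepMatrix

variable {G : Type*} [Group G] [TopologicalSpace G]

/-- The matrix form of an irreducible representation. -/
noncomputable def Irrep.matrix (ρ : Irrep G) : G →* Matrix (Fin ρ.deg) (Fin ρ.deg) ℂ :=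
  (LinearMap.toMatrixAlgEquiv' : _ ≃ₐ[ℂ] Matrix (Fin ρ.deg) (Fin ρ.deg) ℂ).toMonoidHom.comp ρ.rep

theorem Irrep.toLin_matrix (ρ : Irrep G) (g : G) : Matrix.toLin' (ρ.matrix g) = ρ.rep g :=
  Matrix.toLin'_toMatrix' _

theorem Irrep.continuous_matrix (ρ : Irrep G) : Continuous ρ.matrix := by
  refine _root_.continuous_matrix fun i j => ?_
  have h := (continuous_apply i).comp (ρ.continuous_rep (Pi.single j 1))
  refine h.congr fun g => ?_
  exact (LinearMap.toMatrix'_apply (ρ.rep g) i j).symm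

theorem Dual.char_mk (ρ : Irrep G) (g : G) :
    Dual.char (Quotient.mk (irrepSetoid G) ρ) g = (ρ.matrix g).trace := by
  change LinearMap.trace ℂ _ (ρ.rep g) = _
  rw [← ρ.toLin_matrix, Matrix.trace_toLin'_eq]

theorem Irrep.deg_ne_zero (ρ : Irrep G) : ρ.deg ≠ 0 := by
  intro h
  have := ρ.irreducible
  obtain ⟨a, b, hab⟩ := exists_pair_ne (Subrepresentation ρ.rep)
  apply hab
  have hs : Subsingleton (Fin ρ.deg → ℂ) := by
    rw [h]; infer_instance
  exact Subrepresentation.toSubmodule_injective (Subsingleton.elim _ _)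

theorem Irrep.equiv_of_intertwines (ρ σ : Irrep G) {T : Matrix (Fin ρ.deg) (Fin σ.deg) ℂ}
    (hT : ∀ g, ρ.matrix g * T = T * σ.matrix g) (h0 : T ≠ 0) : (irrepSetoid G).r σ ρ := by
  have := ρ.irreducible
  have := σ.irreducible
  let f : Representation.IntertwiningMap σ.rep ρ.rep :=
    LinearMap.intertwiningMap_of_isIntertwiningMap σ.rep ρ.rep (Matrix.toLin' T) (by
      intro g v
      rw [← ρ.toLin_matrix, ← σ.toLin_matrix, ← Matrix.toLin'_mul_apply, ← hT,
        Matrix.toLin'_mul_apply])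
  have hf : (f : (Fin σ.deg → ℂ) → (Fin ρ.deg → ℂ)) = Matrix.toLin' T := rfl
  rcases Representation.IsIrreducible.bijective_or_eq_zero f with h | h
  · exact ⟨LinearEquiv.ofBijective (Matrix.toLin' T) h, f.isIntertwining⟩
  · exfalso
    apply h0
    apply Matrix.toLin'.injective
    rw [map_zero]
    apply DFunLike.coe_injective
    rw [← hf, h]
    rfl

theorem Irrep.eq_smul_one_of_commutes (ρ : Irrep G) {T : Matrix (Fin ρ.deg) (Fin ρ.deg) ℂ}
    (hT : ∀ g, ρ.matrix g * T = T * ρ.matrix g) : ∃ c : ℂ, T = c • 1 := by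
  have := ρ.irreducible
  let f : Representation.IntertwiningMap ρ.rep ρ.rep :=
    LinearMap.intertwiningMap_of_isIntertwiningMap ρ.rep ρ.rep (Matrix.toLin' T) (by
      intro g v
      rw [← ρ.toLin_matrix, ← Matrix.toLin'_mul_apply, ← hT, Matrix.toLin'_mul_apply])
  obtain ⟨c, hc⟩ :=
    Representation.IsIrreducible.algebraMap_intertwiningMap_bijective_of_isAlgClosed.2 f
  refine ⟨c, Matrix.toLin'.injective ?_⟩
  have h1 : Matrix.toLin' T = f.toLinearMap := rfl
  rw [h1, ← hc]
  ext
  simp [Algebra.algebraMap_eq_smul_one]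

variable [IsTopologicalGroup G] [CompactSpace G] [MeasurableSpace G] [BorelSpace G]
  (μ : Measure G) [IsProbabilityMeasure μ] [μ.IsMulLeftInvariant]

theorem integral_char_mul_char_inv_of_not_equiv (ρ σ : Irrep G)
    (h : ¬ (irrepSetoid G).r σ ρ) :
    ∫ g, (ρ.matrix g).trace * (σ.matrix g⁻¹).trace ∂μ = 0 :=
  integral_trace_mul_trace_eq_zero μ ρ.continuous_matrix σ.continuous_matrix fun _ hT =>
    by_contra fun h0 => h (ρ.equiv_of_intertwines σ hT h0)

theorem integral_char_mul_char_inv (ρ : Irrep G) :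
    ∫ g, (ρ.matrix g).trace * (ρ.matrix g⁻¹).trace ∂μ = 1 :=
  integral_trace_mul_trace_inv μ ρ.continuous_matrix ρ.deg_ne_zero fun _ hT =>
    ρ.eq_smul_one_of_commutes hT

end IrrepMatrix

/-! ### The group `SU(2)` -/

section SpecialUnitary

/-- The special unitary group of degree two. -/
abbrev SU2 : Type := Matrix.specialUnitaryGroup (Fin 2) ℂ

instance : IsTopologicalGroup SU2 where
  continuous_mul := continuous_mul
  continuous_inv := Continuous.subtype_mk (continuous_subtype_val.star) _

instance : CompactSpace SU2 := by
  refine isCompact_iff_compactSpace.mp ?_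
  have hK : IsCompact {A : Matrix (Fin 2) (Fin 2) ℂ | ∀ i, A i ∈ {r : Fin 2 → ℂ |
      ∀ j, r j ∈ Metric.closedBall (0 : ℂ) 1}} :=
    isCompact_pi_infinite fun _ => isCompact_pi_infinite fun _ => isCompact_closedBall _ _
  refine hK.of_isClosed_subset ?_ ?_
  · have h : ((Matrix.specialUnitaryGroup (Fin 2) ℂ : Submonoid _) :
        Set (Matrix (Fin 2) (Fin 2) ℂ)) = {A | A * star A = 1} ∩ {A | A.det = 1} := by
      ext A
      simp [Matrix.mem_specialUnitaryGroup_iff, Matrix.mem_unitaryGroup_iff]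
    rw [h]
    exact (isClosed_eq (continuous_id.matrix_mul continuous_id.star) continuous_const).inter
      (isClosed_eq continuous_id.matrix_det continuous_const)
  · intro A hA i j
    rw [mem_closedBall_zero_iff]
    exact entry_norm_bound_of_unitary (Matrix.mem_specialUnitaryGroup_iff.mp hA).1 i j

/-- The special unitary matrix with first column `(x, y)`. -/
noncomputable def suMk (x y : ℂ) (h : x * star x + y * star y = 1) : SU2 :=
  ⟨!![x, -star y; y, star x], by
    rw [Matrix.mem_specialUnitaryGroup_iff, Matrix.mem_unitaryGroup_iff']
    constructor
    · ext i j
      fin_cases i <;> fin_cases j <;>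
        simp [Matrix.mul_apply, Fin.sum_univ_two] <;> simp at h <;>
        first | linear_combination h | ring
    · rw [Matrix.det_fin_two_of]
      linear_combination h⟩

/-- Orthogonality of the columns and determinant one are two linear equations for the second column.
The determinant of this system is the squared norm of the first column, which is one. -/
theorem exists_eq_suMk (g : SU2) : ∃ x y h, g = suMk x y h := by
  have hg := Matrix.mem_specialUnitaryGroup_iff.mp g.2
  have hu := Matrix.mem_unitaryGroup_iff'.mp hg.1
  have hd : g.1 0 0 * g.1 1 1 - g.1 0 1 * g.1 1 0 = 1 := by
    rw [← Matrix.det_fin_two]; exact hg.2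
  have h00 := congrFun (congrFun hu 0) 0
  have h01 := congrFun (congrFun hu 0) 1
  simp only [Matrix.mul_apply, Matrix.star_apply, Fin.sum_univ_two, Matrix.one_apply_eq] at h00
  simp only [Matrix.mul_apply, Matrix.star_apply, Fin.sum_univ_two] at h01
  rw [Matrix.one_apply_ne (by decide)] at h01
  have h11 : g.1 1 1 = star (g.1 0 0) := by
    linear_combination (-g.1 1 1) * h00 + g.1 1 0 * h01 + star (g.1 0 0) * hd
  have h10 : g.1 0 1 = -star (g.1 1 0) := by
    linear_combination (-g.1 0 1) * h00 + g.1 0 0 * h01 - star (g.1 1 0) * hd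
  refine ⟨g.1 0 0, g.1 1 0, by linear_combination h00, ?_⟩
  apply Subtype.ext
  ext i j
  fin_cases i <;> fin_cases j <;> simp [suMk, h11, h10]

/-- The diagonal matrix with entries `exp (± i θ)`. -/
noncomputable def torus (θ : ℝ) : SU2 :=
  suMk (Complex.exp (θ * Complex.I)) 0 (by
    simp [← Complex.exp_conj, ← Complex.exp_add])

theorem torus_val (θ : ℝ) : (torus θ).1 =
    !![Complex.exp (θ * Complex.I), 0; 0, Complex.exp (-(θ * Complex.I))] := by
  simp [torus, suMk, ← Complex.exp_conj]

theorem continuous_torus : Continuous torus := by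
  refine Continuous.subtype_mk (f := fun θ => (torus θ).1) ?_ _
  simp only [torus_val]
  refine _root_.continuous_matrix fun i j => ?_
  fin_cases i <;> fin_cases j <;> simp <;> fun_prop

/-- Half of the trace of an element of `SU(2)`: the cosine of its eigenvalue angle. -/
noncomputable def halfTrace (g : SU2) : ℝ := g.1.trace.re / 2

theorem continuous_halfTrace : Continuous halfTrace :=
  (Complex.continuous_re.comp continuous_subtype_val.matrix_trace).div_const 2

theorem halfTrace_suMk (x y : ℂ) (h) : halfTrace (suMk x y h) = x.re := by
  simp [halfTrace, suMk, Matrix.trace_fin_two]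

theorem halfTrace_inv (g : SU2) : halfTrace g⁻¹ = halfTrace g := by
  have h : (g⁻¹).1 = star g.1 := rfl
  rw [halfTrace, halfTrace, h, Matrix.star_eq_conjTranspose, Matrix.trace_conjTranspose]
  simp

theorem abs_halfTrace_le_one (g : SU2) : |halfTrace g| ≤ 1 := by
  obtain ⟨x, y, h, rfl⟩ := exists_eq_suMk g
  rw [halfTrace_suMk]
  have h1 : Complex.normSq x + Complex.normSq y = 1 := by
    have : ((Complex.normSq x + Complex.normSq y : ℝ) : ℂ) = 1 := by
      push_cast
      rw [← Complex.mul_conj, ← Complex.mul_conj]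
      exact h
    exact_mod_cast this
  rw [abs_le_one_iff_mul_self_le_one]
  have := Complex.normSq_apply x
  nlinarith [Complex.normSq_nonneg y, mul_self_nonneg x.im]

/-- Every element of `SU(2)` is conjugate to an element of the standard maximal torus. -/
theorem exists_conj_eq_torus (g : SU2) :
    ∃ h : SU2, h * torus (Real.arccos (halfTrace g)) * h⁻¹ = g := by
  have hle := abs_le.mp (abs_halfTrace_le_one g)
  obtain ⟨a, b, hab, rfl⟩ := exists_eq_suMk g
  rw [halfTrace_suMk] at hle ⊢
  set θ := Real.arccos a.re
  set t := Complex.exp (θ * Complex.I)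
  have hcos : Real.cos θ = a.re := Real.cos_arccos hle.1 hle.2
  have htt : t * star t = 1 := by
    simp [t, ← Complex.exp_conj, ← Complex.exp_add]
  have hsum : t + star t = a + star a := by
    have h1 : t + star t = ((2 * t.re : ℝ) : ℂ) := Complex.add_conj t
    have h2 : a + star a = ((2 * a.re : ℝ) : ℂ) := Complex.add_conj a
    rw [h1, h2, Complex.exp_ofReal_mul_I_re, hcos]
  -- `t` and `star t` have the trace of `g` as sum and its determinant as product, so `t` is an
  -- eigenvalue.
  have hdet : (!![a - t, -star b; b, star a - t] : Matrix (Fin 2) (Fin 2) ℂ).det = 0 := by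
    rw [Matrix.det_fin_two_of]
    linear_combination hab - htt + t * hsum
  obtain ⟨v, hv0, hv⟩ := Matrix.exists_mulVec_eq_zero_iff.mpr hdet
  have e0 := congrFun hv 0
  have e1 := congrFun hv 1
  simp only [Matrix.mulVec, dotProduct, Fin.sum_univ_two, Matrix.of_apply, Matrix.cons_val',
    Matrix.cons_val_zero, Matrix.cons_val_one, Matrix.cons_val_fin_one, Pi.zero_apply] at e0 e1
  set r : ℝ := Real.sqrt (Complex.normSq (v 0) + Complex.normSq (v 1))
  have hpos : 0 < Complex.normSq (v 0) + Complex.normSq (v 1) := by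
    by_contra hneg
    have p0 := Complex.normSq_nonneg (v 0)
    have p1 := Complex.normSq_nonneg (v 1)
    apply hv0
    ext i
    fin_cases i
    · exact Complex.normSq_eq_zero.mp (le_antisymm (show Complex.normSq (v 0) ≤ 0 by linarith) p0)
    · exact Complex.normSq_eq_zero.mp (le_antisymm (show Complex.normSq (v 1) ≤ 0 by linarith) p1)
  have hr : (r : ℂ) ≠ 0 := Complex.ofReal_ne_zero.mpr (Real.sqrt_pos.mpr hpos).ne'
  have hrr : (r : ℂ) * r = v 0 * star (v 0) + v 1 * star (v 1) := by
    have : r * r = Complex.normSq (v 0) + Complex.normSq (v 1) := Real.mul_self_sqrt hpos.le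
    rw [← Complex.ofReal_mul, this, Complex.ofReal_add, ← Complex.mul_conj, ← Complex.mul_conj]
    rfl
  have hsr : star (r : ℂ) = r := Complex.conj_ofReal r
  have hxy : v 0 / r * star (v 0 / r) + v 1 / r * star (v 1 / r) = 1 := by
    rw [star_div₀, star_div₀, hsr]
    field_simp
    linear_combination -hrr
  refine ⟨suMk (v 0 / r) (v 1 / r) hxy, ?_⟩
  rw [mul_inv_eq_iff_eq_mul]
  have f0 : a * (v 0 / r) - star b * (v 1 / r) = t * (v 0 / r) := by
    field_simp
    linear_combination e0
  have f1 : b * (v 0 / r) + star a * (v 1 / r) = t * (v 1 / r) := by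
    field_simp
    linear_combination e1
  -- Conjugating the eigenvector equations shows that the second column of the conjugator is an
  -- eigenvector for `star t`.
  have g0 := congrArg star f0
  have g1 := congrArg star f1
  simp only [star_sub, star_add, star_mul', star_star] at g0 g1
  apply Subtype.ext
  change (suMk _ _ hxy).1 * (torus θ).1 = (suMk a b hab).1 * (suMk _ _ hxy).1
  have hexp : Complex.exp (-(θ * Complex.I)) = star t := by
    simp [t, ← Complex.exp_conj]
  rw [torus_val, hexp]
  change _ * !![t, 0; 0, star t] = _
  generalize v 0 / r = x at *
  generalize v 1 / r = y at *
  ext i j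
  fin_cases i <;> fin_cases j <;>
    simp only [suMk, Matrix.mul_apply, Fin.sum_univ_two, Matrix.of_apply, Matrix.cons_val',
    Matrix.cons_val_zero, Matrix.cons_val_one, Matrix.cons_val_fin_one, Fin.zero_eta, Fin.mk_one,
    Fin.isValue]
  · linear_combination -f0
  · linear_combination g1
  · linear_combination -f1
  · linear_combination -g0

end SpecialUnitary

/-! ### Binary forms and the symmetric powers of the standard representation -/

section BinaryForm

/-- The function on `ℂ²` given by the binary form of degree `n` with coefficients `c`. -/
noncomputable def binaryForm (n : ℕ) : (Fin (n + 1) → ℂ) →ₗ[ℂ] ((Fin 2 → ℂ) → ℂ) where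
  toFun c v := ∑ k : Fin (n + 1), c k * (v 0 ^ (k : ℕ) * v 1 ^ (n - k))
  map_add' c d := by ext v; simp [add_mul, Finset.sum_add_distrib]
  map_smul' a c := by ext v; simp [mul_assoc, Finset.mul_sum]

theorem binaryForm_apply (n : ℕ) (c : Fin (n + 1) → ℂ) (v : Fin 2 → ℂ) :
    binaryForm n c v = ∑ k : Fin (n + 1), c k * (v 0 ^ (k : ℕ) * v 1 ^ (n - k)) := rfl

theorem binaryForm_single (n : ℕ) (k : Fin (n + 1)) (v : Fin 2 → ℂ) :
    binaryForm n (Pi.single k 1) v = v 0 ^ (k : ℕ) * v 1 ^ (n - k) := by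
  rw [binaryForm_apply, Finset.sum_eq_single k]
  · simp
  · intro b _ hb
    simp [hb]
  · simp

theorem binaryForm_injective (n : ℕ) : Function.Injective (binaryForm n) := by
  rw [← LinearMap.ker_eq_bot, LinearMap.ker_eq_bot']
  intro c hc
  have hp : (∑ k : Fin (n + 1), Polynomial.C (c k) * Polynomial.X ^ (k : ℕ)) = 0 := by
    apply Polynomial.funext
    -- Dehomogenising at `(x, 1)` gives a one-variable polynomial with the same coefficients.
    intro x
    have h := congrFun hc ![x, 1]
    rw [binaryForm_apply] at h
    simpa [Polynomial.eval_finsetSum] using h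
  ext k
  have h := congrArg (fun p => Polynomial.coeff p (k : ℕ)) hp
  simpa [Polynomial.finsetSum_coeff, Polynomial.coeff_C_mul, Polynomial.coeff_X_pow, Fin.val_inj]
    using h

theorem continuous_binaryForm (n : ℕ) (c : Fin (n + 1) → ℂ) : Continuous (binaryForm n c) := by
  change Continuous fun v : Fin 2 → ℂ => ∑ k : Fin (n + 1), c k * (v 0 ^ (k : ℕ) * v 1 ^ (n - k))
  fun_prop

theorem linear_mul_mem_range_binaryForm (p q : ℂ) (n : ℕ) {f : (Fin 2 → ℂ) → ℂ}
    (hf : f ∈ LinearMap.range (binaryForm n)) :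
    (fun v => (p * v 0 + q * v 1) * f v) ∈ LinearMap.range (binaryForm (n + 1)) := by
  obtain ⟨c, rfl⟩ := hf
  -- Multiplication by `v 0` shifts the coefficients up by one; multiplication by `v 1` keeps their
  -- indices.
  refine ⟨p • Fin.cons 0 c + q • Fin.snoc c 0, ?_⟩
  rw [map_add, map_smul, map_smul]
  ext v
  have h1 : binaryForm (n + 1) (Fin.cons 0 c) v = v 0 * binaryForm n c v := by
    rw [binaryForm_apply, Fin.sum_univ_succ, binaryForm_apply, Finset.mul_sum]
    simp only [Fin.cons_zero, zero_mul, zero_add, Fin.cons_succ, Fin.val_succ]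
    refine Finset.sum_congr rfl fun k _ => ?_
    rw [Nat.add_sub_add_right]
    ring
  have h2 : binaryForm (n + 1) (Fin.snoc c 0) v = v 1 * binaryForm n c v := by
    rw [binaryForm_apply, Fin.sum_univ_castSucc, binaryForm_apply, Finset.mul_sum]
    simp only [Fin.snoc_last, zero_mul, add_zero, Fin.snoc_castSucc, Fin.val_castSucc]
    refine Finset.sum_congr rfl fun k _ => ?_
    rw [Nat.succ_sub (Nat.lt_succ_iff.mp k.2), pow_succ]
    ring
  simp only [Pi.add_apply, Pi.smul_apply, smul_eq_mul, h1, h2]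
  ring

theorem pow_mul_pow_mem_range_binaryForm (a b c d : ℂ) (k m : ℕ) :
    (fun v : Fin 2 → ℂ => (a * v 0 + b * v 1) ^ k * (c * v 0 + d * v 1) ^ m) ∈
      LinearMap.range (binaryForm (k + m)) := by
  induction k with
  | zero =>
    induction m with
    | zero => exact ⟨fun _ => 1, by ext v; simp [binaryForm_apply]⟩
    | succ m ih =>
      have h := linear_mul_mem_range_binaryForm c d _ ih
      simp only [pow_zero, one_mul, ← pow_succ'] at h ⊢
      exact h
  | succ k ih =>
    rw [Nat.succ_add]
    convert linear_mul_mem_range_binaryForm a b _ ih using 1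
    ext v
    ring

theorem binaryForm_comp_vecMul_mem_range (n : ℕ) (A : Matrix (Fin 2) (Fin 2) ℂ)
    (c : Fin (n + 1) → ℂ) :
    (fun v => binaryForm n c (Matrix.vecMul v A)) ∈ LinearMap.range (binaryForm n) := by
  have h : (fun v => binaryForm n c (Matrix.vecMul v A)) = ∑ k : Fin (n + 1), c k •
      fun v : Fin 2 → ℂ => (A 0 0 * v 0 + A 1 0 * v 1) ^ (k : ℕ) *
        (A 0 1 * v 0 + A 1 1 * v 1) ^ (n - k) := by
    ext v
    simp only [binaryForm_apply, Matrix.vecMul, dotProduct, Fin.sum_univ_two, Finset.sum_apply,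
      Pi.smul_apply, smul_eq_mul]
    refine Finset.sum_congr rfl fun k _ => ?_
    ring
  rw [h]
  refine Submodule.sum_mem _ fun k _ => Submodule.smul_mem _ _ ?_
  have := pow_mul_pow_mem_range_binaryForm (A 0 0) (A 1 0) (A 0 1) (A 1 1) k (n - k)
  rwa [Nat.add_sub_cancel' (Nat.lt_succ_iff.mp k.2)] at this

/-- Substitution of a matrix into a binary form, on coefficients. -/
noncomputable def formSubst (n : ℕ) (A : Matrix (Fin 2) (Fin 2) ℂ) (c : Fin (n + 1) → ℂ) :
    Fin (n + 1) → ℂ :=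
  (binaryForm_comp_vecMul_mem_range n A c).choose

theorem binaryForm_formSubst (n : ℕ) (A : Matrix (Fin 2) (Fin 2) ℂ) (c : Fin (n + 1) → ℂ)
    (v : Fin 2 → ℂ) :
    binaryForm n (formSubst n A c) v = binaryForm n c (Matrix.vecMul v A) :=
  congrFun (binaryForm_comp_vecMul_mem_range n A c).choose_spec v

theorem eq_formSubst {n : ℕ} {A : Matrix (Fin 2) (Fin 2) ℂ} {c d : Fin (n + 1) → ℂ}
    (h : ∀ v, binaryForm n d v = binaryForm n c (Matrix.vecMul v A)) : formSubst n A c = d := by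
  apply binaryForm_injective
  ext v
  rw [binaryForm_formSubst, h]

/-- The `n`-th symmetric power of the standard representation of `SU(2)`, acting on the
coefficients of binary forms of degree `n`. -/
noncomputable def symRep (n : ℕ) : Representation ℂ SU2 (Fin (n + 1) → ℂ) where
  toFun g :=
    { toFun := formSubst n g.1
      map_add' := fun c d => eq_formSubst fun v => by
        simp only [map_add, Pi.add_apply, binaryForm_formSubst]
      map_smul' := fun a c => eq_formSubst fun v => by
        simp only [map_smul, Pi.smul_apply, binaryForm_formSubst, RingHom.id_apply] }
  map_one' := LinearMap.ext fun c => eq_formSubst fun v => by simp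
  -- Substituting into row vectors, `v ↦ v g`, is what makes this a left action.
  map_mul' g h := LinearMap.ext fun c => eq_formSubst fun v => by
    change binaryForm n (formSubst n g.1 (formSubst n h.1 c)) v = _
    rw [binaryForm_formSubst, binaryForm_formSubst, Matrix.vecMul_vecMul]
    rfl

theorem binaryForm_symRep (n : ℕ) (g : SU2) (c : Fin (n + 1) → ℂ) (v : Fin 2 → ℂ) :
    binaryForm n (symRep n g c) v = binaryForm n c (Matrix.vecMul v g.1) :=
  binaryForm_formSubst n g.1 c v

/-- Coefficients embed topologically into functions on `ℂ²` with pointwise convergence, so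
continuity is tested at each `v`. -/
theorem continuous_symRep (n : ℕ) (c : Fin (n + 1) → ℂ) :
    Continuous fun g : SU2 => symRep n g c := by
  have hemb := LinearMap.isClosedEmbedding_of_injective
    (LinearMap.ker_eq_bot.mpr (binaryForm_injective n))
  rw [hemb.isEmbedding.continuous_iff, continuous_pi_iff]
  intro v
  simp only [Function.comp_apply, binaryForm_symRep]
  exact (continuous_binaryForm n c).comp (continuous_const.matrix_vecMul continuous_subtype_val)

theorem symRep_torus_single (n : ℕ) (θ : ℝ) (k : Fin (n + 1)) :
    symRep n (torus θ) (Pi.single k 1) =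
      Complex.exp (θ * Complex.I * (2 * (k : ℕ) - n)) • Pi.single k 1 := by
  refine eq_formSubst fun v => ?_
  rw [map_smul, Pi.smul_apply, binaryForm_single, binaryForm_single, torus_val]
  simp only [Matrix.vecMul, dotProduct, Fin.sum_univ_two, Matrix.of_apply, Matrix.cons_val',
    Matrix.cons_val_zero, Matrix.cons_val_one, Matrix.cons_val_fin_one, mul_zero, add_zero,
    zero_add, smul_eq_mul, mul_pow, ← Complex.exp_nat_mul]
  have hk : ((n - k : ℕ) : ℂ) = n - (k : ℕ) := Nat.cast_sub (Nat.lt_succ_iff.mp k.2)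
  have he : Complex.exp (θ * Complex.I * (2 * (k : ℕ) - n)) =
      Complex.exp ((k : ℕ) * (θ * Complex.I)) *
        Complex.exp ((n - k : ℕ) * -(θ * Complex.I)) := by
    rw [← Complex.exp_add, hk]
    ring_nf
  rw [he]
  ring

theorem symRep_torus_apply (n : ℕ) (θ : ℝ) (c : Fin (n + 1) → ℂ) (k : Fin (n + 1)) :
    symRep n (torus θ) c k = Complex.exp (θ * Complex.I * (2 * (k : ℕ) - n)) * c k := by
  have hc : c = ∑ j, c j • (Pi.single j 1 : Fin (n + 1) → ℂ) := by
    ext i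
    simp [Finset.sum_apply, Pi.single_apply]
  conv_lhs => rw [hc]
  simp only [map_sum, map_smul, symRep_torus_single, Finset.sum_apply, Pi.smul_apply,
    smul_eq_mul, Pi.single_apply, mul_ite, mul_one, mul_zero, Finset.sum_ite_eq,
    Finset.mem_univ, if_true]
  ring

/-- Since the eigenvalues are distinct, the projection to a coordinate is a Lagrange polynomial in
the diagonal operator. -/
theorem single_mem_of_diagonal_invariant {ι : Type*} [Fintype ι] [DecidableEq ι] {w : ι → ℂ}
    (hw : Function.Injective w) (U : Submodule ℂ (ι → ℂ)) (hU : ∀ c ∈ U, w * c ∈ U)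
    {c : ι → ℂ} (hc : c ∈ U) (k : ι) : Pi.single k (c k) ∈ U := by
  have hpow : ∀ j : ℕ, w ^ j * c ∈ U := by
    intro j
    induction j with
    | zero => simpa using hc
    | succ j ih =>
      rw [pow_succ', mul_assoc]
      exact hU _ ih
  have hpoly : ∀ p : Polynomial ℂ, (fun i => p.eval (w i) * c i) ∈ U := by
    intro p
    induction p using Polynomial.induction_on' with
    | add p q hp hq =>
      convert U.add_mem hp hq using 1
      ext i
      simp [add_mul]
    | monomial j a =>
      convert U.smul_mem a (hpow j) using 1
      ext i
      simp [mul_assoc]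
  convert hpoly (Lagrange.basis Finset.univ w k) using 1
  ext i
  by_cases hik : i = k
  · subst hik
    rw [Lagrange.eval_basis_self hw.injOn (Finset.mem_univ _)]
    simp
  · rw [Lagrange.eval_basis_of_ne (Ne.symm hik) (Finset.mem_univ _)]
    simp [hik]

/-- At the angle `π / (n + 1)` two weights have ratio `exp (2πi (j - k) / (n + 1))`, which is one
only if `n + 1` divides `j - k`. -/
theorem torus_weights_injective (n : ℕ) : Function.Injective fun k : Fin (n + 1) =>
    Complex.exp ((Real.pi / (n + 1) : ℝ) * Complex.I * (2 * (k : ℕ) - n)) := by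
  intro j k h
  obtain ⟨m, hm⟩ := Complex.exp_eq_exp_iff_exists_int.mp h
  have hn : ((n : ℂ) + 1) ≠ 0 := Nat.cast_add_one_ne_zero n
  have hpi : (Real.pi : ℂ) ≠ 0 := Complex.ofReal_ne_zero.mpr Real.pi_ne_zero
  push_cast at hm
  field_simp at hm
  have h2 : ((j : ℕ) : ℤ) = (k : ℕ) + (n + 1) * m := by
    have : (2 * ((j : ℕ) : ℂ)) = 2 * (((k : ℕ) : ℂ) + (n + 1) * m) := by linear_combination hm
    have := mul_left_cancel₀ two_ne_zero this
    exact_mod_cast this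
  have hj := j.2
  have hk := k.2
  have hm0 : m = 0 := by
    rcases lt_trichotomy m 0 with h | h | h
    · nlinarith
    · exact h
    · nlinarith
  subst hm0
  ext
  omega

/-- The rotation with rational entries `3 / 5` and `4 / 5`. -/
noncomputable def pythagoreanRotation : SU2 :=
  suMk (3 / 5) (4 / 5) (by simp; norm_num)

theorem binaryForm_symRep_pythagoreanRotation (n : ℕ) (k : Fin (n + 1)) (v : Fin 2 → ℂ) :
    binaryForm n (symRep n pythagoreanRotation (Pi.single k 1)) v =
      (3 / 5 * v 0 + 4 / 5 * v 1) ^ (k : ℕ) * (-(4 / 5) * v 0 + 3 / 5 * v 1) ^ (n - k) := by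
  rw [binaryForm_symRep, binaryForm_single]
  simp only [pythagoreanRotation, suMk, Matrix.vecMul, dotProduct, Fin.sum_univ_two,
    Matrix.of_apply, Matrix.cons_val', Matrix.cons_val_zero, Matrix.cons_val_one,
    Matrix.cons_val_fin_one]
  have h3 : star (3 / 5 : ℂ) = 3 / 5 := by simp
  have h4 : star (4 / 5 : ℂ) = 4 / 5 := by simp
  rw [h3, h4]
  ring

theorem symRep_pythagoreanRotation_single_last (n : ℕ) (k : Fin (n + 1)) :
    symRep n pythagoreanRotation (Pi.single k 1) (Fin.last n) =
      (3 / 5) ^ (k : ℕ) * (-(4 / 5)) ^ (n - k) := by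
  -- At `(1, 0)` only the top coefficient survives.
  have h := binaryForm_symRep_pythagoreanRotation n k ![1, 0]
  rw [binaryForm_apply, Fin.sum_univ_castSucc, Finset.sum_eq_zero] at h
  · simpa using h
  · intro j _
    have : n - (j : ℕ) ≠ 0 := by omega
    simp [this]

theorem symRep_pythagoreanRotation_last_single (n : ℕ) (k : Fin (n + 1)) :
    symRep n pythagoreanRotation (Pi.single (Fin.last n) 1) k =
      (3 / 5) ^ (k : ℕ) * (4 / 5) ^ (n - k) * n.choose k := by
  have h : symRep n pythagoreanRotation (Pi.single (Fin.last n) 1) =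
      fun k : Fin (n + 1) => (3 / 5 : ℂ) ^ (k : ℕ) * (4 / 5) ^ (n - k) * n.choose k := by
    apply binaryForm_injective
    ext v
    rw [binaryForm_symRep_pythagoreanRotation, binaryForm_apply,
      Fin.sum_univ_eq_sum_range (fun k => (3 / 5 : ℂ) ^ k * (4 / 5) ^ (n - k) * n.choose k *
        (v 0 ^ k * v 1 ^ (n - k))) (n + 1), Fin.val_last, Nat.sub_self, pow_zero, mul_one, add_pow]
    refine Finset.sum_congr rfl fun k _ => ?_
    rw [mul_pow, mul_pow]
    ring
  rw [h]

/-- The torus splits a nonzero invariant subspace into monomials. A single rotation with nonzero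
entries then carries any monomial to a form involving the top one, and the top one to a form
involving all. -/
theorem symRep_isIrreducible (n : ℕ) : (symRep n).IsIrreducible := by
  have hnt : Nontrivial (Subrepresentation (symRep n)) := by
    refine ⟨⊥, ⊤, fun h => ?_⟩
    have h1 : (Pi.single 0 1 : Fin (n + 1) → ℂ) ∈ (⊤ : Subrepresentation (symRep n)) :=
      Submodule.mem_top
    rw [← h] at h1
    have h2 : (Pi.single 0 1 : Fin (n + 1) → ℂ) = 0 := (Submodule.mem_bot ℂ).mp h1
    simpa using congrFun h2 0
  refine { hnt with eq_bot_or_eq_top := fun U => or_iff_not_imp_left.mpr fun hU => ?_ }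
  have hsingle : ∀ c ∈ U.toSubmodule, ∀ k, c k ≠ 0 → Pi.single k 1 ∈ U.toSubmodule := by
    intro c hc k hk
    have h := single_mem_of_diagonal_invariant (torus_weights_injective n) U.toSubmodule
      (fun d hd => by
        convert U.apply_mem_toSubmodule (torus (Real.pi / (n + 1))) hd using 1
        ext k
        rw [symRep_torus_apply]
        rfl) hc k
    convert U.toSubmodule.smul_mem (c k)⁻¹ h using 1
    rw [← Pi.single_smul, smul_eq_mul, inv_mul_cancel₀ hk]
  have hne : U.toSubmodule ≠ ⊥ := fun h => hU (Subrepresentation.toSubmodule_injective h)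
  obtain ⟨c, hc, hc0⟩ := U.toSubmodule.ne_bot_iff.mp hne
  obtain ⟨k, hk⟩ := Function.ne_iff.mp hc0
  have hlast : Pi.single (Fin.last n) 1 ∈ U.toSubmodule := by
    refine hsingle _ (U.apply_mem_toSubmodule pythagoreanRotation (hsingle c hc k hk)) _ ?_
    rw [symRep_pythagoreanRotation_single_last]
    exact mul_ne_zero (pow_ne_zero _ (by norm_num)) (pow_ne_zero _ (by norm_num))
  have hall : ∀ k, Pi.single k 1 ∈ U.toSubmodule := by
    intro k
    refine hsingle _ (U.apply_mem_toSubmodule pythagoreanRotation hlast) _ ?_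
    rw [symRep_pythagoreanRotation_last_single]
    exact mul_ne_zero (mul_ne_zero (pow_ne_zero _ (by norm_num)) (pow_ne_zero _ (by norm_num)))
      (Nat.cast_ne_zero.mpr (Nat.choose_pos (Nat.lt_succ_iff.mp k.2)).ne')
  apply Subrepresentation.toSubmodule_injective
  change U.toSubmodule = ⊤
  rw [eq_top_iff]
  intro d _
  have hd : d = ∑ j, d j • (Pi.single j 1 : Fin (n + 1) → ℂ) := by
    ext i
    simp [Finset.sum_apply, Pi.single_apply]
  rw [hd]
  exact Submodule.sum_mem _ fun j _ => Submodule.smul_mem _ _ (hall j)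

/-- The `n`-th symmetric power as an irreducible representation of degree `n + 1`. -/
noncomputable def symIrrep (n : ℕ) : Irrep SU2 where
  deg := n + 1
  rep := symRep n
  continuous_rep := continuous_symRep n
  irreducible := symRep_isIrreducible n

/-- The weight sums obey the Chebyshev recurrence: shifting the weights of degree `n + 1` up gives
those of degree `n + 2` except the lowest, and shifting them down gives that lowest one and the
weights of degree `n`. No division by `sin θ` is needed. -/
theorem sum_exp_eq_eval_U (n : ℕ) (θ : ℝ) :
    ∑ k : Fin (n + 1), Complex.exp (θ * Complex.I * (2 * (k : ℕ) - n)) =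
      (Polynomial.Chebyshev.U ℂ n).eval (Real.cos θ : ℂ) := by
  rw [Fin.sum_univ_eq_sum_range fun k : ℕ => Complex.exp (θ * Complex.I * (2 * k - n))]
  induction n using Nat.twoStepInduction with
  | zero => simp
  | one =>
    simp [Finset.sum_range_succ, Complex.cos]
    ring_nf
  | more n ih1 ih2 =>
    have hU : Polynomial.Chebyshev.U ℂ ((n + 2 : ℕ) : ℤ) = 2 * Polynomial.X *
        Polynomial.Chebyshev.U ℂ ((n + 1 : ℕ) : ℤ) - Polynomial.Chebyshev.U ℂ (n : ℤ) := by
      push_cast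
      exact Polynomial.Chebyshev.U_add_two ℂ n
    rw [hU, Polynomial.eval_sub, Polynomial.eval_mul, Polynomial.eval_mul, Polynomial.eval_X,
      Polynomial.eval_ofNat, ← ih1, ← ih2, Complex.ofReal_cos, Complex.two_cos, add_mul]
    have e1 : Complex.exp (θ * Complex.I) * ∑ k ∈ Finset.range (n + 1 + 1),
        Complex.exp (θ * Complex.I * (2 * k - (n + 1 : ℕ))) = ∑ k ∈ Finset.range (n + 2),
        Complex.exp (θ * Complex.I * (2 * (k + 1 : ℕ) - (n + 2 : ℕ))) := by
      rw [Finset.mul_sum]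
      refine Finset.sum_congr rfl fun k _ => ?_
      rw [← Complex.exp_add]
      congr 1
      push_cast
      ring
    have e2 : Complex.exp (-θ * Complex.I) * ∑ k ∈ Finset.range (n + 1 + 1),
        Complex.exp (θ * Complex.I * (2 * k - (n + 1 : ℕ))) =
        Complex.exp (θ * Complex.I * (2 * (0 : ℕ) - (n + 2 : ℕ))) +
        ∑ k ∈ Finset.range (n + 1), Complex.exp (θ * Complex.I * (2 * k - n)) := by
      rw [Finset.mul_sum, Finset.sum_range_succ', add_comm]
      congr 1
      · rw [← Complex.exp_add]
        congr 1
        push_cast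
        ring
      · refine Finset.sum_congr rfl fun k _ => ?_
        rw [← Complex.exp_add]
        congr 1
        push_cast
        ring
    rw [e1, e2, Finset.sum_range_succ']
    ring

theorem trace_symIrrep_torus (n : ℕ) (θ : ℝ) :
    ((symIrrep n).matrix (torus θ)).trace =
      (Polynomial.Chebyshev.U ℂ n).eval (Real.cos θ : ℂ) := by
  rw [← sum_exp_eq_eval_U]
  refine Finset.sum_congr rfl fun (k : Fin (n + 1)) _ => ?_
  refine (LinearMap.toMatrix'_apply (symRep n (torus θ)) k k).trans ?_
  rw [symRep_torus_apply]
  simp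

theorem trace_matrix_eq_torus (ρ : Irrep SU2) (g : SU2) :
    (ρ.matrix g).trace = (ρ.matrix (torus (Real.arccos (halfTrace g)))).trace := by
  obtain ⟨h, hh⟩ := exists_conj_eq_torus g
  conv_lhs => rw [← hh, map_mul, Matrix.trace_mul_comm, ← map_mul, ← mul_assoc, inv_mul_cancel,
    one_mul]

theorem trace_symIrrep (n : ℕ) (g : SU2) :
    ((symIrrep n).matrix g).trace = (Polynomial.Chebyshev.U ℂ n).eval (halfTrace g : ℂ) := by
  have h := abs_le.mp (abs_halfTrace_le_one g)
  rw [trace_matrix_eq_torus, trace_symIrrep_torus, Real.cos_arccos h.1 h.2]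

end BinaryForm

/-! ### Classification of the irreducible representations of `SU(2)` -/

section Classification

theorem exists_complex_polynomial_near {f : ℝ → ℂ} (hf : Continuous f) (a b : ℝ) {ε : ℝ}
    (hε : 0 < ε) :
    ∃ p : Polynomial ℂ, ∀ x ∈ Set.Icc a b, ‖f x - p.eval (x : ℂ)‖ < ε := by
  obtain ⟨u, hu⟩ := exists_polynomial_near_of_continuousOn a b (fun x => (f x).re)
    (Complex.continuous_re.comp hf).continuousOn (ε / 2) (half_pos hε)
  obtain ⟨v, hv⟩ := exists_polynomial_near_of_continuousOn a b (fun x => (f x).im)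
    (Complex.continuous_im.comp hf).continuousOn (ε / 2) (half_pos hε)
  refine ⟨u.map Complex.ofRealHom + Polynomial.C Complex.I * v.map Complex.ofRealHom,
    fun x hx => ?_⟩
  have hmap : ∀ q : Polynomial ℝ, (q.map Complex.ofRealHom).eval (x : ℂ) = (q.eval x : ℝ) :=
    fun q => Polynomial.eval_map_apply Complex.ofRealHom x
  rw [Polynomial.eval_add, Polynomial.eval_mul, Polynomial.eval_C, hmap, hmap]
  have h1 := hu x hx
  have h2 := hv x hx
  rw [abs_sub_comm] at h1 h2
  refine (Complex.norm_le_abs_re_add_abs_im _).trans_lt ?_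
  simp only [Complex.sub_re, Complex.add_re, Complex.ofReal_re, Complex.mul_re, Complex.I_re,
    zero_mul, Complex.ofReal_im, mul_zero, sub_zero, add_zero, Complex.sub_im, Complex.add_im,
    Complex.mul_im, Complex.I_im, one_mul, zero_add]
  linarith

theorem span_chebyshev_U :
    Submodule.span ℂ (Set.range fun n : ℕ => Polynomial.Chebyshev.U ℂ n) = ⊤ :=
  Polynomial.Sequence.span
    (S := ⟨fun n : ℕ => Polynomial.Chebyshev.U ℂ n, Polynomial.Chebyshev.degree_U_natCast ℂ⟩)
    fun n => by
      change IsUnit (Polynomial.Chebyshev.U ℂ (n : ℤ)).leadingCoeff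
      rw [Polynomial.Chebyshev.leadingCoeff_U_natCast]
      exact (pow_ne_zero _ two_ne_zero).isUnit

theorem exists_equiv_symIrrep (ρ : Irrep SU2) : ∃ n, (irrepSetoid SU2).r (symIrrep n) ρ := by
  by_contra! hne
  let _ : MeasurableSpace SU2 := borel SU2
  have : BorelSpace SU2 := ⟨rfl⟩
  let μ : Measure SU2 := Measure.haarMeasure ⊤
  have : IsProbabilityMeasure μ := ⟨Measure.haarMeasure_self⟩
  let f : ℝ → ℂ := fun x => (ρ.matrix (torus (Real.arccos x))).trace
  have hf : Continuous f :=
    (ρ.continuous_matrix.comp (continuous_torus.comp Real.continuous_arccos)).matrix_trace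
  have hfc : Continuous fun g => f (halfTrace g) := hf.comp continuous_halfTrace
  have hint : ∀ {F : SU2 → ℂ}, Continuous F → Integrable F μ := fun hF =>
    hF.integrable_of_hasCompactSupport (HasCompactSupport.of_compactSpace _)
  have hpc : ∀ p : Polynomial ℂ, Continuous fun g : SU2 => p.eval (halfTrace g : ℂ) := fun p =>
    p.continuous.comp (Complex.continuous_ofReal.comp continuous_halfTrace)
  have hm : ∀ p : Polynomial ℂ,
      Continuous fun g : SU2 => f (halfTrace g) * p.eval (halfTrace g : ℂ) := fun p =>
    hfc.mul (hpc p)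
  have hff : Continuous fun g : SU2 => f (halfTrace g) * f (halfTrace g) := hfc.mul hfc
  have hρ : ∀ g, (ρ.matrix g).trace = f (halfTrace g) := trace_matrix_eq_torus ρ
  -- The half trace is invariant under inversion, so Schur orthogonality applies without inverses;
  -- linearity extends it from the `U_n` to all polynomials.
  have horth : ∀ p : Polynomial ℂ, ∫ g, f (halfTrace g) * p.eval (halfTrace g : ℂ) ∂μ = 0 := by
    intro p
    have hp : p ∈ Submodule.span ℂ (Set.range fun n : ℕ => Polynomial.Chebyshev.U ℂ n) := by
      rw [span_chebyshev_U]
      trivial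
    induction hp using Submodule.span_induction with
    | mem q hq =>
      obtain ⟨n, rfl⟩ := hq
      have h := integral_char_mul_char_inv_of_not_equiv μ ρ (symIrrep n) (hne n)
      simpa only [trace_symIrrep, hρ, halfTrace_inv] using h
    | zero => simp
    | add q r _ _ hq hr =>
      simp only [Polynomial.eval_add, mul_add]
      rw [integral_add (hint (hm q)) (hint (hm r)), hq, hr, add_zero]
    | smul a q _ hq =>
      simp only [Polynomial.eval_smul, smul_eq_mul, mul_left_comm _ a]
      rw [integral_const_mul, hq, mul_zero]
  have hone : ∫ g, f (halfTrace g) * f (halfTrace g) ∂μ = 1 := by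
    have h := integral_char_mul_char_inv μ ρ
    simpa only [hρ, halfTrace_inv] using h
  obtain ⟨M, hM⟩ := isCompact_univ.exists_bound_of_continuousOn hfc.continuousOn
  have hM0 : 0 ≤ M := (norm_nonneg _).trans (hM 1 trivial)
  -- With error `1 / (M + 1)` the integral of norm one is at most `M / (M + 1) < 1`.
  obtain ⟨p, hp⟩ := exists_complex_polynomial_near hf (-1) 1 (inv_pos.mpr (by linarith : 0 < M + 1))
  have hdiff : ∫ g, f (halfTrace g) * (f (halfTrace g) - p.eval (halfTrace g : ℂ)) ∂μ = 1 := by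
    simp only [mul_sub]
    rw [integral_sub (hint hff) (hint (hm p)), hone, horth, sub_zero]
  have hle := norm_integral_le_of_norm_le_const (μ := μ)
    (f := fun g => f (halfTrace g) * (f (halfTrace g) - p.eval (halfTrace g : ℂ)))
    (C := M * (M + 1)⁻¹) (Filter.Eventually.of_forall fun g => by
      rw [norm_mul]
      exact mul_le_mul (hM g trivial) (hp _ (abs_le.mp (abs_halfTrace_le_one g))).le
        (norm_nonneg _) hM0)
  rw [hdiff, norm_one, probReal_univ, mul_one, ← div_eq_mul_inv, le_div_iff₀ (by linarith)] at hle
  linarith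

/-- The dual of `SU(2)` is parametrised by the symmetric powers of the standard representation. -/
noncomputable def dualEquiv : ℕ ≃ Dual SU2 :=
  Equiv.ofBijective (fun n => Quotient.mk (irrepSetoid SU2) (symIrrep n))
    ⟨fun m n h => by
      have hd : m + 1 = n + 1 := congrArg Dual.deg h
      exact Nat.succ_injective hd,
    fun c => by
      induction c using Quotient.inductionOn with
      | h ρ =>
        obtain ⟨n, hn⟩ := exists_equiv_symIrrep ρ
        exact ⟨n, Quotient.sound hn⟩⟩

theorem deg_dualEquiv (n : ℕ) : (dualEquiv n).deg = n + 1 := rfl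

theorem char_dualEquiv (n : ℕ) (g : SU2) :
    (dualEquiv n).char g = (Polynomial.Chebyshev.U ℂ n).eval (halfTrace g : ℂ) :=
  (Dual.char_mk (symIrrep n) g).trans (trace_symIrrep n g)

theorem hasSum_wittenTerm_iff (g₁ g₂ : SU2) (s A : ℂ) :
    HasSum (wittenTerm ![g₁, g₂] s) A ↔
      HasSum (fun n : ℕ => (Polynomial.Chebyshev.U ℂ n).eval (halfTrace g₁ : ℂ) / (n + 1 : ℕ) *
        ((Polynomial.Chebyshev.U ℂ n).eval (halfTrace g₂ : ℂ) / (n + 1 : ℕ)) *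
          ((n + 1 : ℕ) : ℂ) ^ (-s)) A := by
  rw [← dualEquiv.hasSum_iff]
  simp only [Function.comp_def, wittenTerm, Fin.prod_univ_two, Matrix.cons_val_zero,
    Matrix.cons_val_one, Matrix.cons_val_fin_one, char_dualEquiv, deg_dualEquiv]

end Classification

/-! ### Analytic continuation -/

section Continuation

open HurwitzZeta

/-- The completed function is entire up to rational terms and `1 / Gammaℝ` is entire; the value
reassigned at one point does not affect meromorphy. -/
theorem meromorphicAt_cosZeta (a : UnitAddCircle) (s : ℂ) : MeromorphicAt (cosZeta a) s := by
  have hG : MeromorphicAt (fun s => (Complex.Gammaℝ s)⁻¹) s :=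
    (Complex.differentiable_Gammaℝ_inv.analyticAt s).meromorphicAt
  have h0 : MeromorphicAt (completedCosZeta₀ a) s :=
    ((differentiable_completedCosZeta₀ a).analyticAt s).meromorphicAt
  have hc : MeromorphicAt (fun s => completedCosZeta a s / Complex.Gammaℝ s) s := by
    simp only [completedCosZeta_eq, div_eq_mul_inv _ (Complex.Gammaℝ _)]
    fun_prop
  exact hc.update _ _

theorem analyticAt_cosZeta (a : UnitAddCircle) {s : ℂ} (hs : s ≠ 1) :
    AnalyticAt ℂ (cosZeta a) s := by
  rw [Complex.analyticAt_iff_eventually_differentiableAt]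
  filter_upwards [isOpen_ne.mem_nhds hs] with z hz
  exact differentiableAt_cosZeta a (Or.inl hz)

theorem hasSum_cos_div_succ_cpow (φ : ℝ) {s : ℂ} (hs : 1 < s.re) :
    HasSum (fun n : ℕ => (Real.cos ((n + 1 : ℕ) * φ) : ℂ) / ((n + 1 : ℕ) : ℂ) ^ s)
      (cosZeta ((φ / (2 * Real.pi) : ℝ) : UnitAddCircle) s) := by
  have h := hasSum_nat_cosZeta (φ / (2 * Real.pi)) hs
  rw [← hasSum_nat_add_iff' 1] at h
  -- The term of index zero is `1 / 0 ^ s`, which is `0` by convention once `0 ^ s = 0`.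
  have hs0 : s ≠ 0 := by rintro rfl; norm_num at hs
  simp only [Finset.sum_range_one, Nat.cast_zero, Complex.zero_cpow hs0, div_zero, sub_zero] at h
  refine h.congr_fun fun n => ?_
  rw [mul_div_cancel₀ φ Real.two_pi_pos.ne', mul_comm φ]

theorem hasSum_sin_div_succ_cpow (φ : ℝ) {s : ℂ} (hs : 1 < s.re) :
    HasSum (fun n : ℕ => (Real.sin ((n + 1 : ℕ) * φ) : ℂ) / ((n + 1 : ℕ) : ℂ) ^ s)
      (sinZeta ((φ / (2 * Real.pi) : ℝ) : UnitAddCircle) s) := by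
  have h := hasSum_nat_sinZeta (φ / (2 * Real.pi)) hs
  rw [← hasSum_nat_add_iff' 1] at h
  have hs0 : s ≠ 0 := by rintro rfl; norm_num at hs
  simp only [Finset.sum_range_one, Nat.cast_zero, Complex.zero_cpow hs0, div_zero, sub_zero] at h
  refine h.congr_fun fun n => ?_
  rw [mul_div_cancel₀ φ Real.two_pi_pos.ne', mul_comm φ]

theorem cosZeta_neg_even (a : UnitAddCircle) {m : ℕ} (hm : 0 < m) (hme : Even m) :
    cosZeta a (-(m : ℂ)) = 0 := by
  obtain ⟨k, rfl⟩ := hme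
  obtain ⟨j, rfl⟩ : ∃ j, k = j + 1 := ⟨k - 1, by omega⟩
  rw [← cosZeta_neg_two_mul_nat_add_one a j]
  congr 1
  push_cast
  ring

theorem sinZeta_one_sub_even (a : UnitAddCircle) {m : ℕ} (hm : 0 < m) (hme : Even m) :
    sinZeta a (-(m : ℂ) + 1) = 0 := by
  obtain ⟨k, rfl⟩ := hme
  obtain ⟨j, rfl⟩ : ∃ j, k = j + 1 := ⟨k - 1, by omega⟩
  rw [← sinZeta_neg_two_mul_nat_sub_one a j]
  congr 1
  push_cast
  ring

/-- For `m = 2` the argument is `0`, where the value does not depend on the angle; for larger `m` it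
is a trivial zero. -/
theorem cosZeta_two_sub_even_eq (a b : UnitAddCircle) {m : ℕ} (hm : 0 < m) (hme : Even m) :
    cosZeta a (-(m : ℂ) + 2) = cosZeta b (-(m : ℂ) + 2) := by
  obtain ⟨k, rfl⟩ := hme
  obtain ⟨j, rfl⟩ : ∃ j, k = j + 1 := ⟨k - 1, by omega⟩
  have e : -(((j + 1 + (j + 1) : ℕ)) : ℂ) + 2 = -((j + j : ℕ) : ℂ) := by push_cast; ring
  rw [e]
  rcases Nat.eq_zero_or_pos j with rfl | hj
  · simp [cosZeta_apply_zero]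
  · rw [cosZeta_neg_even a (by omega) ⟨j, rfl⟩, cosZeta_neg_even b (by omega) ⟨j, rfl⟩]

/-- The Dirichlet series `∑ aₙ (n + 1)⁻ˢ` converges far to the right, and has a meromorphic
continuation to the plane that vanishes at the negative even integers. -/
def HasContinuationWithTrivialZeros (a : ℕ → ℂ) : Prop :=
  ∃ F : ℂ → ℂ, MeromorphicOn F Set.univ ∧
    (∀ s : ℂ, 1 < s.re → AnalyticAt ℂ F s ∧
      HasSum (fun n => a n * ((n + 1 : ℕ) : ℂ) ^ (-s)) (F s)) ∧
    ∀ m : ℕ, 0 < m → Even m → AnalyticAt ℂ F (-(m : ℂ)) ∧ F (-(m : ℂ)) = 0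

theorem ne_one_of_one_lt_re {s : ℂ} (hs : 1 < s.re) : s ≠ 1 := by
  rintro rfl
  norm_num at hs

theorem succ_cast_ne_zero (n : ℕ) : ((n + 1 : ℕ) : ℂ) ≠ 0 := Nat.cast_ne_zero.mpr n.succ_ne_zero

theorem hasContinuation_cos (C : ℂ) (φ : ℝ) :
    HasContinuationWithTrivialZeros fun n => C * Real.cos ((n + 1 : ℕ) * φ) := by
  refine ⟨fun s => C * cosZeta ((φ / (2 * Real.pi) : ℝ) : UnitAddCircle) s,
    fun s _ => (MeromorphicAt.const C s).mul (meromorphicAt_cosZeta _ s), fun s hs => ⟨?_, ?_⟩,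
    fun m hm hme => ⟨?_, ?_⟩⟩
  · exact analyticAt_const.mul (analyticAt_cosZeta _ (ne_one_of_one_lt_re hs))
  · refine ((hasSum_cos_div_succ_cpow φ hs).mul_left C).congr_fun fun n => ?_
    rw [Complex.cpow_neg, div_eq_mul_inv, mul_assoc]
  · refine analyticAt_const.mul (analyticAt_cosZeta _ fun h => ?_)
    have := congrArg Complex.re h
    simp at this
    linarith [(Nat.cast_nonneg m : (0 : ℝ) ≤ m)]
  · simp only [cosZeta_neg_even _ hm hme, mul_zero]

theorem hasContinuation_sin_div (C : ℂ) (φ : ℝ) :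
    HasContinuationWithTrivialZeros fun n =>
      C * Real.sin ((n + 1 : ℕ) * φ) / ((n + 1 : ℕ) : ℂ) := by
  have ha : ∀ s, AnalyticAt ℂ (fun s : ℂ =>
      C * sinZeta ((φ / (2 * Real.pi) : ℝ) : UnitAddCircle) (s + 1)) s := fun s =>
    Differentiable.analyticAt ((differentiable_const C).mul
      ((differentiableAt_sinZeta _).comp (differentiable_id.add_const 1))) s
  refine ⟨_, fun s _ => (ha s).meromorphicAt, fun s hs => ⟨ha s, ?_⟩,
    fun m hm hme => ⟨ha _, ?_⟩⟩
  · have hs' : 1 < (s + 1).re := by simp; linarith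
    refine ((hasSum_sin_div_succ_cpow φ hs').mul_left C).congr_fun fun n => ?_
    rw [Complex.cpow_neg, Complex.cpow_add _ _ (succ_cast_ne_zero n), Complex.cpow_one,
      ← div_eq_mul_inv, div_div, mul_div_assoc, mul_comm (((n + 1 : ℕ) : ℂ) ^ s)]
  · simp only [sinZeta_one_sub_even _ hm hme, mul_zero]

theorem hasContinuation_cos_sub_cos_div (C : ℂ) (φ ψ : ℝ) :
    HasContinuationWithTrivialZeros fun n =>
      C * (Real.cos ((n + 1 : ℕ) * φ) - Real.cos ((n + 1 : ℕ) * ψ)) / ((n + 1 : ℕ) : ℂ) ^ 2 := by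
  set F : ℂ → ℂ := fun s => C * (cosZeta ((φ / (2 * Real.pi) : ℝ) : UnitAddCircle) (s + 2) -
    cosZeta ((ψ / (2 * Real.pi) : ℝ) : UnitAddCircle) (s + 2)) with hF
  have hshift : ∀ s, AnalyticAt ℂ (fun s : ℂ => s + 2) s := fun s =>
    analyticAt_id.add analyticAt_const
  have hmer : ∀ (a : UnitAddCircle) s, MeromorphicAt (fun s => cosZeta a (s + 2)) s := by
    intro a s
    exact (meromorphicAt_cosZeta a (s + 2)).comp_analyticAt (g := fun s : ℂ => s + 2) (hshift s)
  have han : ∀ s : ℂ, s ≠ -1 → AnalyticAt ℂ F s := by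
    intro s hs
    have hs' : s + 2 ≠ 1 := fun h => hs (by linear_combination h)
    exact analyticAt_const.mul
      (((analyticAt_cosZeta _ hs').comp_of_eq (hshift s) rfl).sub
        ((analyticAt_cosZeta _ hs').comp_of_eq (hshift s) rfl))
  refine ⟨F, fun s _ => (MeromorphicAt.const C s).mul ((hmer _ s).sub (hmer _ s)),
    fun s hs => ⟨han s ?_, ?_⟩, fun m hm hme => ⟨han _ ?_, ?_⟩⟩
  · rintro rfl
    norm_num at hs
  · have hs' : 1 < (s + 2).re := by simp; linarith
    refine (((hasSum_cos_div_succ_cpow φ hs').sub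
      (hasSum_cos_div_succ_cpow ψ hs')).mul_left C).congr_fun fun n => ?_
    rw [Complex.cpow_neg, Complex.cpow_add _ _ (succ_cast_ne_zero n), Complex.cpow_ofNat,
      ← sub_div, ← div_eq_mul_inv, div_div, mul_div_assoc, mul_comm (((n + 1 : ℕ) : ℂ) ^ s)]
  -- The only possible pole is at `s = -1`, which is odd.
  · intro h
    have h1 : m = 1 := by exact_mod_cast neg_injective h
    subst h1
    exact absurd hme (by decide)
  · rw [hF]
    simp only [cosZeta_two_sub_even_eq _ ((ψ / (2 * Real.pi) : ℝ) : UnitAddCircle) hm hme,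
      sub_self, mul_zero]

/-! ### Character values and the three cases of the Dirichlet series -/

theorem U_eval_cos_of_sin_ne_zero {θ : ℝ} (hθ : Real.sin θ ≠ 0) (n : ℕ) :
    (Polynomial.Chebyshev.U ℂ n).eval (Real.cos θ : ℂ) =
      Real.sin ((n + 1 : ℕ) * θ) / Real.sin θ := by
  have h := Polynomial.Chebyshev.U_complex_cos (θ : ℂ) n
  rw [eq_div_iff (Complex.ofReal_ne_zero.mpr hθ)]
  push_cast at h ⊢
  exact h

theorem sin_mul_succ_eq_zero {θ : ℝ} (hθ : Real.sin θ = 0) (n : ℕ) :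
    Real.sin (n * θ) = 0 := by
  induction n with
  | zero => simp
  | succ n ih =>
    push_cast
    rw [add_mul, one_mul, Real.sin_add, ih, hθ]
    simp

/-- Here `cos θ = ± 1` and the value is `(± 1) ^ n * (n + 1)`. Writing the sign through a cosine
lets the addition formulas absorb it into the other angle. -/
theorem U_eval_cos_of_sin_eq_zero {θ : ℝ} (hθ : Real.sin θ = 0) (n : ℕ) :
    (Polynomial.Chebyshev.U ℂ n).eval (Real.cos θ : ℂ) =
      Real.cos θ * Real.cos ((n + 1 : ℕ) * θ) * ((n + 1 : ℕ) : ℂ) := by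
  have hsq : (Real.cos θ : ℂ) * Real.cos θ = 1 := by
    have h := Real.sin_sq_add_cos_sq θ
    rw [hθ] at h
    rw [← Complex.ofReal_mul, ← sq, ← Complex.ofReal_one]
    congr 1
    linarith
  have hcos : ∀ k : ℕ, Real.cos ((k + 1 : ℕ) * θ) = Real.cos (k * θ) * Real.cos θ := by
    intro k
    push_cast
    rw [add_mul, one_mul, Real.cos_add, hθ, mul_zero, sub_zero]
  induction n using Nat.twoStepInduction with
  | zero => simpa using hsq.symm
  | one =>
    rw [hcos, hcos, Nat.cast_zero, zero_mul, Real.cos_zero, Nat.cast_one,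
      Polynomial.Chebyshev.U_one, Polynomial.eval_mul, Polynomial.eval_ofNat, Polynomial.eval_X]
    simp only [Complex.ofReal_mul, Complex.ofReal_one, Nat.cast_add, Nat.cast_one]
    linear_combination (-2 * (Real.cos θ : ℂ)) * hsq
  | more n ih1 ih2 =>
    have hU : Polynomial.Chebyshev.U ℂ ((n + 2 : ℕ) : ℤ) = 2 * Polynomial.X *
        Polynomial.Chebyshev.U ℂ ((n + 1 : ℕ) : ℤ) - Polynomial.Chebyshev.U ℂ (n : ℤ) := by
      push_cast
      exact Polynomial.Chebyshev.U_add_two ℂ n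
    rw [hU, Polynomial.eval_sub, Polynomial.eval_mul, Polynomial.eval_mul, Polynomial.eval_X,
      Polynomial.eval_ofNat, ih1, ih2, hcos (n + 2), hcos (n + 1)]
    generalize Real.cos ((n + 1 : ℕ) * θ) = x
    simp only [Complex.ofReal_mul]
    generalize (Real.cos θ : ℂ) = y at hsq
    push_cast
    linear_combination (x * y * (n + 1)) * hsq

theorem hasContinuation_of_sin_ne_zero_of_sin_eq_zero {θ₁ θ₂ : ℝ} (h₁ : Real.sin θ₁ ≠ 0)
    (h₂ : Real.sin θ₂ = 0) :
    HasContinuationWithTrivialZeros fun n =>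
      (Polynomial.Chebyshev.U ℂ n).eval (Real.cos θ₁ : ℂ) / (n + 1 : ℕ) *
        ((Polynomial.Chebyshev.U ℂ n).eval (Real.cos θ₂ : ℂ) / (n + 1 : ℕ)) := by
  convert hasContinuation_sin_div (Real.cos θ₂ / Real.sin θ₁) (θ₁ + θ₂) using 2 with n
  have hN := succ_cast_ne_zero n
  have hs : (Real.sin θ₁ : ℂ) ≠ 0 := Complex.ofReal_ne_zero.mpr h₁
  rw [U_eval_cos_of_sin_ne_zero h₁, U_eval_cos_of_sin_eq_zero h₂, mul_add, Real.sin_add,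
    sin_mul_succ_eq_zero h₂, mul_zero, add_zero, Complex.ofReal_mul]
  field_simp

theorem hasContinuation_U_mul_U (θ₁ θ₂ : ℝ) :
    HasContinuationWithTrivialZeros fun n =>
      (Polynomial.Chebyshev.U ℂ n).eval (Real.cos θ₁ : ℂ) / (n + 1 : ℕ) *
        ((Polynomial.Chebyshev.U ℂ n).eval (Real.cos θ₂ : ℂ) / (n + 1 : ℕ)) := by
  by_cases h₁ : Real.sin θ₁ = 0 <;> by_cases h₂ : Real.sin θ₂ = 0
  · convert hasContinuation_cos (Real.cos θ₁ * Real.cos θ₂) (θ₁ + θ₂) using 2 with n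
    have hN := succ_cast_ne_zero n
    rw [U_eval_cos_of_sin_eq_zero h₁, U_eval_cos_of_sin_eq_zero h₂, mul_add, Real.cos_add,
      sin_mul_succ_eq_zero h₂, mul_zero, sub_zero, Complex.ofReal_mul]
    field_simp
  · simp only [mul_comm (Polynomial.eval (Real.cos θ₁ : ℂ) _ / _)]
    exact hasContinuation_of_sin_ne_zero_of_sin_eq_zero h₂ h₁
  · exact hasContinuation_of_sin_ne_zero_of_sin_eq_zero h₁ h₂
  -- Product-to-sum: `2 sin x sin y = cos (x - y) - cos (x + y)`.
  · convert hasContinuation_cos_sub_cos_div (2 * Real.sin θ₁ * Real.sin θ₂ : ℂ)⁻¹ (θ₁ - θ₂)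
      (θ₁ + θ₂) using 2 with n
    have hN := succ_cast_ne_zero n
    have hs1 : (Real.sin θ₁ : ℂ) ≠ 0 := Complex.ofReal_ne_zero.mpr h₁
    have hs2 : (Real.sin θ₂ : ℂ) ≠ 0 := Complex.ofReal_ne_zero.mpr h₂
    rw [U_eval_cos_of_sin_ne_zero h₁, U_eval_cos_of_sin_ne_zero h₂,
      mul_add (R := ℝ), mul_sub (α := ℝ), Real.cos_add, Real.cos_sub]
    push_cast
    push_cast at hN hs1 hs2
    field_simp
    ring

/-- Identity theorem: on the connected plane, a meromorphic difference of infinite order at one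
point has infinite order everywhere. -/
theorem eventuallyEq_nhdsNE_of_eqOn_halfPlane {F H : ℂ → ℂ} (hF : MeromorphicOn F Set.univ)
    (hH : MeromorphicOn H Set.univ) {σ : ℝ} (h : ∀ s : ℂ, σ < s.re → F s = H s) (z : ℂ) :
    F =ᶠ[𝓝[≠] z] H := by
  by_contra hz
  have hsub : MeromorphicOn (F - H) Set.univ := hF.sub hH
  have hord : meromorphicOrderAt (F - H) z ≠ ⊤ := by
    rw [ne_eq, meromorphicOrderAt_eq_top_iff]
    refine fun h0 => hz ?_
    filter_upwards [h0] with w hw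
    exact sub_eq_zero.mp hw
  have hfar := hsub.meromorphicOrderAt_ne_top_of_isPreconnected isPreconnected_univ
    (Set.mem_univ z) (Set.mem_univ ((σ + 1 : ℝ) : ℂ)) hord
  apply hfar
  rw [meromorphicOrderAt_eq_top_iff]
  apply Filter.Eventually.filter_mono nhdsWithin_le_nhds
  have hopen : IsOpen {s : ℂ | σ < s.re} := isOpen_lt continuous_const Complex.continuous_re
  filter_upwards [hopen.mem_nhds (by simp : ((σ + 1 : ℝ) : ℂ) ∈ {s : ℂ | σ < s.re})] with w hw
  exact sub_eq_zero.mpr (h w hw)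

end Continuation

end WittenL

theorem theorem2 (g₁ g₂ : Matrix.specialUnitaryGroup (Fin 2) ℂ) :
    (∃ F : ℂ → ℂ, WittenL.IsWittenLFunction ![g₁, g₂] F) ∧
      ∀ F : ℂ → ℂ, WittenL.IsWittenLFunction ![g₁, g₂] F →
        ∀ m : ℕ, 0 < m → Even m → AnalyticAt ℂ F (-(m : ℂ)) ∧ F (-(m : ℂ)) = 0 := by
  have hcos : ∀ g, Real.cos (Real.arccos (WittenL.halfTrace g)) = WittenL.halfTrace g := fun g =>
    Real.cos_arccos (abs_le.mp (WittenL.abs_halfTrace_le_one g)).1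
      (abs_le.mp (WittenL.abs_halfTrace_le_one g)).2
  obtain ⟨H, hmer, hsum, hzero⟩ := WittenL.hasContinuation_U_mul_U
    (Real.arccos (WittenL.halfTrace g₁)) (Real.arccos (WittenL.halfTrace g₂))
  simp only [hcos] at hsum
  -- `H` may have arbitrary values at its poles; normalising leaves it unchanged wherever it is
  -- analytic, in particular for `re s > 1`.
  refine ⟨⟨toMeromorphicNFOn H Set.univ, meromorphicNFOn_toMeromorphicNFOn _ _, 1,
    fun s hs => ?_⟩, ?_⟩
  · rw [WittenL.hasSum_wittenTerm_iff, toMeromorphicNFOn_eq_toMeromorphicNFAt hmer (Set.mem_univ s),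
      toMeromorphicNFAt_eq_self.mpr (hsum s hs).1.meromorphicNFAt]
    exact (hsum s hs).2
  · rintro F ⟨hF, σ, hσ⟩ m hm hme
    obtain ⟨ha, h0⟩ := hzero m hm hme
    have heq : F =ᶠ[𝓝 (-(m : ℂ))] H := by
      -- Both functions are in normal form at `-m`, so agreement on a punctured neighbourhood
      -- includes the centre.
      refine ((hF (Set.mem_univ _)).eventuallyEq_nhdsNE_iff_eventuallyEq_nhds
        ha.meromorphicNFAt).mp ?_
      refine WittenL.eventuallyEq_nhdsNE_of_eqOn_halfPlane hF.meromorphicOn hmer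
        (σ := max σ 1) (fun s hs => ?_) _
      exact ((WittenL.hasSum_wittenTerm_iff g₁ g₂ s _).mp
        (hσ s ((le_max_left _ _).trans_lt hs))).unique
          (hsum s ((le_max_right _ _).trans_lt hs)).2
    exact ⟨ha.congr heq.symm, heq.eq_of_nhds.trans h0⟩
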